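/- Let $X$ be a complex Banach space with dual $X'$, and let $T(\cdot)=(T(t))_{t\ge 0}$ be an exponentially stable $C_0$-semigroup on $X$ with generator $A$; let $X_1$ be $D(A)$ with the graph norm. Let $\mathcal H^\infty_-$ be the space of bounded holomorphic functions on $\mathbb C_-=\{z\in\mathbb C:\operatorname{Re} z<0\}$; each $g\in\mathcal H^\infty_-$ has a boundary function $g(i\omega)=\lim_{r\uparrow 0}g(r+i\omega)$ for almost every $\omega\in\mathbb R$. Let $\mathfrak L$ be the Laplace transform, regarded on $L^2(0,\infty)$ as a map $f\mapsto\big(i\omega\mapsto\int_0^\infty e^{-i\omega t}f(t)\,dt\big)$ into $L^2(i\mathbb R)$ (Plancherel), let $\mathcal H^2=\mathfrak L(L^2(0,\infty))$ be the Hardy space of the right half-plane, let $\Pi$ be the orthogonal projection of $L^2(i\mathbb R)$ onto $\mathcal H^2$, and let $M_g:L^2(0,\infty)\to L^2(0,\infty)$, $M_gf=\mathfrak L^{-1}\Pi(g\cdot\mathfrak L f)$, be the Toeplitz operator with symbol $g$. The operator $g(A):D(A)\to X$ is the unique operator in $\mathcal B(X_1,X)$ such that $$M_g\big(\langle y,T(\cdot)x\rangle\big)=\langle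 y,g(A)T(\cdot)x\rangle\quad\text{in }L^2(0,\infty)\qquad\text{for all }x\in D(A),\ y\in X'.$$ **Lemma.** Let $g\in\mathcal H^\infty_-$ be the Fourier transform of a function $h\in L^1(\mathbb R)$ with support in $(-\infty,0]$, i.e. $h=0$ almost everywhere on $(0,\infty)$ and $g(i\omega)=\int_{\mathbb R}e^{-i\omega t}h(t)\,dt$ for almost every $\omega\in\mathbb R$. Then $g(A)$ exists and is unique, the function $s\mapsto h(-s)T(s)x$ is integrable on $(0,\infty)$ for every $x\in X$, and $$g(A)x=\int_0^\infty h(-s)T(s)x\,ds\qquad\text{for all }x\in D(A).$$ Hence $g(A)$ is bounded in the norm of $X$ and extends to a unique operator in $\mathcal B(X)$, namely to the Phillips calculus operator $x\mapsto\int_0^\infty h(-s)T(s)x\,ds$, $x\in X$. -/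

import Mathlib

open MeasureTheory Filter Topology Set

noncomputable section

/-! ### Strongly continuous semigroups and their generators -/

/-- A `C₀`-semigroup `T(t)`, `t ≥ 0`, of bounded operators on a complex normed space `X`. Only the
values `T t` with `0 ≤ t` carry information; the other values are never used. -/
structure C0Semigroup (X : Type*) [NormedAddCommGroup X] [NormedSpace ℂ X] where
  /-- the operators of the semigroup -/
  toFun : ℝ → X →L[ℂ] X
  at_zero : toFun 0 = ContinuousLinearMap.id ℂ X
  at_add : ∀ s t : ℝ, 0 ≤ s → 0 ≤ t → toFun (s + t) = (toFun s).comp (toFun t)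
  continuousOn_orbit : ∀ x : X, ContinuousOn (fun t => toFun t x) (Ici 0)

namespace C0Semigroup

variable {X : Type*} [NormedAddCommGroup X] [NormedSpace ℂ X] (T : C0Semigroup X)

instance : CoeFun (C0Semigroup X) (fun _ => ℝ → X →L[ℂ] X) := ⟨C0Semigroup.toFun⟩

/-- Exponential stability: the growth bound is negative. -/
def IsExponentiallyStable : Prop :=
  ∃ M ε : ℝ, 0 < ε ∧ ∀ t : ℝ, 0 ≤ t → ‖T t‖ ≤ M * Real.exp (-ε * t)

/-- `y` is the right derivative at `0` of the orbit of `x`, i.e. `x ∈ D(A)` and `A x = y`. -/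
def HasGenerator (x y : X) : Prop :=
  Tendsto (fun t : ℝ => t⁻¹ • (T t x - x)) (𝓝[>] 0) (𝓝 y)

theorem HasGenerator.add {x y x' y' : X} (h : T.HasGenerator x y) (h' : T.HasGenerator x' y') :
    T.HasGenerator (x + x') (y + y') := by
  refine (Tendsto.add h h').congr fun t => ?_
  rw [← smul_add, map_add]
  congr 1
  abel

theorem HasGenerator.smul (c : ℂ) {x y : X} (h : T.HasGenerator x y) :
    T.HasGenerator (c • x) (c • y) := by
  refine (Tendsto.const_smul h c).congr fun t => ?_
  rw [smul_comm, map_smul, smul_sub]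

theorem HasGenerator.unique {x y z : X} (h : T.HasGenerator x y) (h' : T.HasGenerator x z) :
    y = z :=
  tendsto_nhds_unique h h'

/-- The domain `D(A)` of the generator. -/
def domain : Submodule ℂ X where
  carrier := {x | ∃ y, T.HasGenerator x y}
  zero_mem' := ⟨0, by simp [HasGenerator]⟩
  add_mem' := fun ⟨_, h⟩ ⟨_, h'⟩ => ⟨_, h.add T h'⟩
  smul_mem' := fun c _ ⟨_, h⟩ => ⟨_, h.smul T c⟩

theorem hasGenerator_choose (x : T.domain) : T.HasGenerator x (Classical.choose x.2) :=
  Classical.choose_spec x.2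

/-- The generator `A : D(A) → X` of the semigroup. -/
def generator : T.domain →ₗ[ℂ] X where
  toFun x := Classical.choose x.2
  map_add' x x' := (T.hasGenerator_choose (x + x')).unique T
    ((T.hasGenerator_choose x).add T (T.hasGenerator_choose x'))
  map_smul' c x := (T.hasGenerator_choose (c • x)).unique T ((T.hasGenerator_choose x).smul T c)

/-- `D(A)` is invariant under the semigroup. -/
theorem apply_mem_domain {t : ℝ} (ht : 0 ≤ t) {x : X} (hx : x ∈ T.domain) :
    T t x ∈ T.domain := by
  obtain ⟨y, hy⟩ := hx
  refine ⟨T t y, ?_⟩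
  have h := ((T t).continuous.tendsto y).comp hy
  refine h.congr' ?_
  filter_upwards [self_mem_nhdsWithin] with r hr
  have hr' : (0 : ℝ) ≤ r := le_of_lt hr
  have e : T r (T t x) = T t (T r x) := by
    have h1 := T.at_add r t hr' ht
    have h2 := T.at_add t r ht hr'
    rw [add_comm] at h1
    rw [h1] at h2
    exact congrArg (fun S : X →L[ℂ] X => S x) h2
  rw [e]
  simp only [Function.comp_apply]
  have : (r⁻¹ • (T r x - x)) = ((r⁻¹ : ℝ) : ℂ) • (T r x - x) := (Complex.coe_smul _ _).symm
  rw [this, map_smul, map_sub, Complex.coe_smul]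

/-- The scalar orbit `t ↦ ⟨y, T(t)x⟩` belongs to `L²(0,∞)` if `T` is exponentially stable. -/
theorem memLp_orbit (hT : T.IsExponentiallyStable) (y : StrongDual ℂ X) (x : X) :
    MemLp (fun t : ℝ => y (T t x)) 2 (volume.restrict (Ioi 0)) := by
  obtain ⟨M, ε, hε, hM⟩ := hT
  have hmeas : AEStronglyMeasurable (fun t : ℝ => y (T t x)) (volume.restrict (Ioi 0)) := by
    refine ContinuousOn.aestronglyMeasurable ?_ measurableSet_Ioi
    exact y.continuous.comp_continuousOn ((T.continuousOn_orbit x).mono Ioi_subset_Ici_self)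
  have hexp : MemLp (fun t : ℝ => (‖y‖ * (M * ‖x‖)) * Real.exp (-ε * t)) 2
      (volume.restrict (Ioi 0)) := by
    refine MemLp.const_mul ?_ _
    rw [memLp_two_iff_integrable_sq (by fun_prop)]
    have := exp_neg_integrableOn_Ioi 0 (mul_pos two_pos hε)
    refine this.congr (ae_of_all _ fun t => ?_)
    simp only
    rw [← Real.exp_nat_mul]
    congr 1
    push_cast
    ring
  refine hexp.mono hmeas ?_
  filter_upwards [ae_restrict_mem measurableSet_Ioi] with t ht
  have h1 : ‖y (T t x)‖ ≤ ‖y‖ * ((M * Real.exp (-ε * t)) * ‖x‖) :=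
    (y.le_opNorm _).trans (mul_le_mul_of_nonneg_left
      (((T t).le_opNorm x).trans (mul_le_mul_of_nonneg_right (hM t (le_of_lt ht)) (norm_nonneg _)))
      (norm_nonneg _))
  refine h1.trans (le_trans (le_of_eq ?_) (Real.le_norm_self _))
  ring

end C0Semigroup

/-! ### Bounded holomorphic functions on the left half-plane and their boundary functions -/

/-- The space `H^∞_-` of bounded holomorphic functions on `ℂ_- = {z | Re z < 0}` (the values outside
`ℂ_-` are never used). -/
structure HInfLeft where
  /-- the function -/
  toFun : ℂ → ℂ
  differentiableOn : DifferentiableOn ℂ toFun {z | z.re < 0}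
  bounded : ∃ c : ℝ, ∀ z : ℂ, z.re < 0 → ‖toFun z‖ ≤ c

namespace HInfLeft

variable (g : HInfLeft)

/-- `g` has the boundary value `l` at the point `iω` of the imaginary axis. -/
def HasBoundaryValue (ω : ℝ) (l : ℂ) : Prop :=
  Tendsto (fun r : ℝ => g.toFun (r + ω * Complex.I)) (𝓝[<] 0) (𝓝 l)

open Classical in
/-- The boundary function `ω ↦ g(iω) = lim_{r ↑ 0} g(r + iω)`; the limit exists for almost every
`ω`, and the value is set to `0` on the exceptional null set. -/
def boundary (ω : ℝ) : ℂ :=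
  if h : ∃ l, g.HasBoundaryValue ω l then Classical.choose h else 0

theorem boundary_eq {ω : ℝ} {l : ℂ} (h : g.HasBoundaryValue ω l) : g.boundary ω = l := by
  have h' : ∃ l, g.HasBoundaryValue ω l := ⟨l, h⟩
  rw [boundary, dif_pos h']
  exact tendsto_nhds_unique (Classical.choose_spec h') h

theorem continuousOn_horizontal (ω : ℝ) :
    ContinuousOn (fun r : ℝ => g.toFun (r + ω * Complex.I)) (Iio 0) := by
  refine g.differentiableOn.continuousOn.comp (by fun_prop) ?_
  intro r hr
  simpa using hr

theorem continuous_vertical {r : ℝ} (hr : r < 0) :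
    Continuous (fun ω : ℝ => g.toFun (r + ω * Complex.I)) := by
  rw [← continuousOn_univ]
  refine g.differentiableOn.continuousOn.comp (by fun_prop) ?_
  intro ω _
  simpa using hr

/-- The boundary value may be computed along negative rationals. -/
theorem hasBoundaryValue_iff (ω : ℝ) (l : ℂ) : g.HasBoundaryValue ω l ↔
    Tendsto (fun q : {q : ℚ // (q : ℝ) < 0} => g.toFun (((q : ℚ) : ℝ) + ω * Complex.I))
      (comap (fun q : {q : ℚ // (q : ℝ) < 0} => ((q : ℚ) : ℝ)) (𝓝 0)) (𝓝 l) := by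
  constructor
  · intro h
    have : Tendsto (fun q : {q : ℚ // (q : ℝ) < 0} => ((q : ℚ) : ℝ))
        (comap (fun q : {q : ℚ // (q : ℝ) < 0} => ((q : ℚ) : ℝ)) (𝓝 0)) (𝓝[<] 0) :=
      tendsto_nhdsWithin_iff.2 ⟨tendsto_comap, Eventually.of_forall fun q => q.2⟩
    exact Tendsto.comp (f := fun q : {q : ℚ // (q : ℝ) < 0} => ((q : ℚ) : ℝ)) h this
  · intro h
    refine (Metric.nhds_basis_closedBall (x := l)).tendsto_right_iff.2 fun ε hε => ?_
    have h1 := (Metric.nhds_basis_closedBall (x := l)).tendsto_right_iff.1 h ε hε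
    rw [eventually_comap] at h1
    obtain ⟨δ, hδ, hd⟩ := Metric.eventually_nhds_iff.1 h1
    have hmem : Ioo (-δ) 0 ∈ 𝓝[<] (0 : ℝ) := Ioo_mem_nhdsLT (by linarith)
    filter_upwards [hmem] with r hr
    by_contra hcon
    have hopen : IsOpen (Ioo (-δ) 0 ∩ (fun r : ℝ => g.toFun (r + ω * Complex.I)) ⁻¹'
        (Metric.closedBall l ε)ᶜ) :=
      ((g.continuousOn_horizontal ω).mono Ioo_subset_Iio_self).isOpen_inter_preimage isOpen_Ioo
        Metric.isClosed_closedBall.isOpen_compl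
    obtain ⟨q, hq⟩ := Rat.denseRange_cast.exists_mem_open hopen ⟨r, hr, hcon⟩
    refine hq.2 (hd (y := (q : ℝ)) ?_ ⟨q, hq.1.2⟩ rfl)
    rw [Real.dist_eq, sub_zero, abs_of_neg hq.1.2]
    linarith [hq.1.1]

theorem measurable_boundary : Measurable g.boundary := by
  set L := comap (fun q : {q : ℚ // (q : ℝ) < 0} => ((q : ℚ) : ℝ)) (𝓝 0)
  set F : {q : ℚ // (q : ℝ) < 0} → ℝ → ℂ :=
    fun q ω => g.toFun (((q : ℚ) : ℝ) + ω * Complex.I)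
  have hF : ∀ q, StronglyMeasurable (F q) := fun q => (g.continuous_vertical q.2).stronglyMeasurable
  have hS : MeasurableSet {ω | ∃ l, Tendsto (fun q => F q ω) L (𝓝 l)} :=
    StronglyMeasurable.measurableSet_exists_tendsto hF
  have hlim : Measurable (fun ω => limUnder L (fun q => F q ω)) :=
    (StronglyMeasurable.limUnder hF).measurable
  have hne : L.NeBot := by
    refine comap_neBot fun t ht => ?_
    obtain ⟨δ, hδ, hd⟩ := Metric.mem_nhds_iff.1 ht
    obtain ⟨q, hq1, hq2⟩ := exists_rat_btwn (show -δ < 0 by linarith)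
    refine ⟨⟨q, hq2⟩, hd ?_⟩
    simp only [Metric.mem_ball, Real.dist_eq, sub_zero]
    rw [abs_of_neg hq2]
    linarith
  classical
  have : g.boundary = fun ω => if ω ∈ {ω | ∃ l, Tendsto (fun q => F q ω) L (𝓝 l)} then
      limUnder L (fun q => F q ω) else 0 := by
    funext ω
    by_cases h : ∃ l, g.HasBoundaryValue ω l
    · obtain ⟨l, hl⟩ := h
      have hl' := (g.hasBoundaryValue_iff ω l).1 hl
      rw [g.boundary_eq hl, if_pos ⟨l, hl'⟩]
      exact (Tendsto.limUnder_eq hl').symm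
    · rw [boundary, dif_neg h, if_neg]
      rintro ⟨l, hl⟩
      exact h ⟨l, (g.hasBoundaryValue_iff ω l).2 hl⟩
  rw [this]
  exact Measurable.ite hS hlim measurable_const

theorem exists_norm_boundary_le : ∃ c : ℝ, ∀ ω, ‖g.boundary ω‖ ≤ c := by
  obtain ⟨c, hc⟩ := g.bounded
  have hc0 : 0 ≤ c := (norm_nonneg _).trans (hc (-1) (by simp))
  refine ⟨c, fun ω => ?_⟩
  by_cases h : ∃ l, g.HasBoundaryValue ω l
  · obtain ⟨l, hl⟩ := h
    rw [g.boundary_eq hl]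
    refine le_of_tendsto (Tendsto.norm hl) ?_
    filter_upwards [self_mem_nhdsWithin] with r hr
    exact hc _ (by simpa using hr)
  · rw [boundary, dif_neg h]
    simpa using hc0

/-- The product of the boundary function of `g` with an `L²`-function on the imaginary axis is again
in `L²`; the imaginary axis is parametrised by `ξ ↦ 2πiξ`. -/
theorem memLp_boundary_mul (u : Lp ℂ 2 (volume : Measure ℝ)) :
    MemLp (fun ξ : ℝ => g.boundary (2 * Real.pi * ξ) * u ξ) 2 volume := by
  obtain ⟨c, hc⟩ := g.exists_norm_boundary_le
  have hm : Measurable fun ξ : ℝ => g.boundary (2 * Real.pi * ξ) :=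
    g.measurable_boundary.comp (by fun_prop)
  refine MemLp.of_le_mul (c := c) (Lp.memLp u)
    (hm.aestronglyMeasurable.mul (Lp.aestronglyMeasurable u)) (ae_of_all _ fun ξ => ?_)
  rw [norm_mul]
  exact mul_le_mul_of_nonneg_right (hc _) (norm_nonneg _)

/-- The product `g · u` of (the boundary function of) `g` with `u ∈ L²(iℝ)`. -/
def mulBoundary (u : Lp ℂ 2 (volume : Measure ℝ)) : Lp ℂ 2 (volume : Measure ℝ) :=
  (g.memLp_boundary_mul u).toLp

end HInfLeft

/-! ### The Hardy space and Toeplitz operators -/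

/-- The space `L²(0,∞)`. -/
abbrev L2Half := Lp ℂ 2 (volume.restrict (Ioi (0 : ℝ)))

theorem memLp_indicator_half (f : L2Half) :
    MemLp ((Ioi (0 : ℝ)).indicator f) 2 (volume : Measure ℝ) :=
  (memLp_indicator_iff_restrict measurableSet_Ioi).2 (Lp.memLp f)

/-- Extension by zero, `L²(0,∞) → L²(ℝ)`, `f ↦ f_ext`. -/
def extendZero : L2Half →ₗᵢ[ℂ] Lp ℂ 2 (volume : Measure ℝ) where
  toFun f := (memLp_indicator_half f).toLp
  map_add' f f' := by
    rw [← MemLp.toLp_add, MemLp.toLp_eq_toLp_iff]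
    have h := (ae_restrict_iff' measurableSet_Ioi).1 (Lp.coeFn_add f f')
    filter_upwards [h] with t ht
    by_cases h0 : t ∈ Ioi (0 : ℝ)
    · rw [indicator_of_mem h0, ht h0, Pi.add_apply, Pi.add_apply, indicator_of_mem h0,
        indicator_of_mem h0]
    · simp [indicator_of_notMem h0]
  map_smul' c f := by
    rw [RingHom.id_apply, ← MemLp.toLp_const_smul, MemLp.toLp_eq_toLp_iff]
    have h := (ae_restrict_iff' measurableSet_Ioi).1 (Lp.coeFn_smul c f)
    filter_upwards [h] with t ht
    by_cases h0 : t ∈ Ioi (0 : ℝ)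
    · simp [indicator_of_mem h0, ht h0]
    · simp [indicator_of_notMem h0]
  norm_map' f := by
    change ‖(memLp_indicator_half f).toLp‖ = ‖f‖
    rw [Lp.norm_toLp, eLpNorm_indicator_eq_eLpNorm_restrict measurableSet_Ioi, Lp.norm_def]

/-- The Laplace transform `L²(0,∞) → L²(iℝ)`, i.e. the boundary function `(𝔏f)(2πiξ)` of the Laplace
transform of `f`; it is the (Plancherel) Fourier transform `∫ e^{-2πiξt} f_ext(t) dt`. -/
def laplaceBoundary : L2Half →ₗᵢ[ℂ] Lp ℂ 2 (volume : Measure ℝ) :=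
  (Lp.fourierTransformₗᵢ ℝ ℂ).toLinearIsometry.comp extendZero

/-- The Hardy space `H²` of the right half-plane, seen through boundary functions: the Laplace
transforms of the functions in `L²(0,∞)`. -/
abbrev hardySpace : Submodule ℂ (Lp ℂ 2 (volume : Measure ℝ)) :=
  LinearMap.range laplaceBoundary.toLinearMap

instance : CompleteSpace hardySpace :=
  (completeSpace_congr (e := laplaceBoundary.equivRange.toEquiv)
    laplaceBoundary.equivRange.isometry.isUniformEmbedding).1 inferInstance

/-- The Toeplitz operator `M_g : L²(0,∞) → L²(0,∞)`, `M_g f = 𝔏⁻¹ Π (g · 𝔏 f)`, where `Π` is the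
orthogonal projection of `L²(iℝ)` onto `H²`. -/
def toeplitz (g : HInfLeft) (f : L2Half) : L2Half :=
  laplaceBoundary.equivRange.symm
    (hardySpace.orthogonalProjectionOnto (g.mulBoundary (laplaceBoundary f)))

/-! ### The weakly admissible `H^∞_-`-calculus -/

namespace C0Semigroup

variable {X : Type*} [NormedAddCommGroup X] [NormedSpace ℂ X] (T : C0Semigroup X)

/-- The output mapping `𝔇_{g,y} x = M_g ⟨y, T(·)x⟩ ∈ L²(0,∞)`. -/
def outputMap (hT : T.IsExponentiallyStable) (g : HInfLeft) (y : StrongDual ℂ X) (x : X) : L2Half :=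
  toeplitz g (T.memLp_orbit hT y x).toLp

/-- The defining property of the operator `g(A) ∈ B(X₁, X)`, where `X₁` is `D(A)` with the graph
norm: `C` is bounded from `X₁` to `X`, and `𝔇_{g,y} x = ⟨y, C T(·)x⟩` in `L²(0,∞)` for all `y ∈ X'`
and all `x ∈ D(A)`. -/
def IsCalculusOperator (hT : T.IsExponentiallyStable) (g : HInfLeft) (C : T.domain →ₗ[ℂ] X) : Prop :=
  (∃ c : ℝ, ∀ x : T.domain, ‖C x‖ ≤ c * (‖(x : X)‖ + ‖T.generator x‖)) ∧
  ∀ (y : StrongDual ℂ X) (x : T.domain), ∀ᵐ t ∂(volume.restrict (Ioi (0 : ℝ))), ∀ ht : 0 ≤ t,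
    T.outputMap hT g y x t = y (C ⟨T t x, T.apply_mem_domain ht x.2⟩)

open Classical in
/-- The operator `g(A) : D(A) → X`, the unique operator with the defining property
`IsCalculusOperator`. -/
def calculus (hT : T.IsExponentiallyStable) (g : HInfLeft) : T.domain →ₗ[ℂ] X :=
  if h : ∃ C, T.IsCalculusOperator hT g C then Classical.choose h else 0

end C0Semigroup

end

/-! Multiplying `𝔏 f` by the Fourier transform of `h` gives the transform of the convolution of `h`
with the zero extension of `f`, and projecting onto the Hardy space restricts that convolution to
the half-line. As `h` lives on the negative axis, `M_g f (t) = ∫₀^∞ h(-s) f(t+s) ds`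
(`coeFn_toeplitz_eq_integral`). For `f = ⟨y, T(·)x⟩` the semigroup law `T(t+s) = T(s)T(t)` turns
this into `⟨y, E T(t)x⟩` with `E` the Phillips operator, so `E` restricted to `D(A)` has the
defining property (`phillips_isCalculusOperator`). That property determines the operator, because
almost every `t` includes some `t` arbitrarily close to `0` and `T(t)x → x` in graph norm. Density
of `D(A)` makes the bounded extension unique. -/

section Toeplitz

open scoped FourierTransform Convolution

/-! ### Toeplitz operators with symbol the Fourier transform of `h` -/

/-- On `L¹ ∩ L²` the Plancherel transform is given by the Fourier integral. -/
theorem coeFn_fourierTransform_toLp {f : ℝ → ℂ} (h1 : Integrable f) (h2 : MemLp f 2 volume) :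
    (Lp.fourierTransformₗᵢ ℝ ℂ h2.toLp : ℝ → ℂ) =ᵐ[volume] 𝓕 f := by
  have hcont : Continuous (𝓕 f) :=
    VectorFourier.fourierIntegral_continuous Real.continuous_fourierChar
      (L := innerₗ ℝ) (by simpa using! continuous_inner) h1
  -- Both sides are locally integrable, so it suffices to test against smooth compactly supported
  -- functions, which are Schwartz; there the `L²` transform agrees with the distributional one.
  refine ae_eq_of_integral_contDiff_smul_eq
    ((Lp.memLp (Lp.fourierTransformₗᵢ ℝ ℂ h2.toLp)).locallyIntegrable one_le_two)
    hcont.locallyIntegrable fun φ hφ hφc => ?_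
  have hg₁ : HasCompactSupport (Complex.ofRealCLM ∘ φ) := hφc.comp_left rfl
  have hg₂ : ContDiff ℝ (⊤ : ℕ∞) (Complex.ofRealCLM ∘ φ) := by fun_prop
  set ψ : SchwartzMap ℝ ℂ := hg₁.toSchwartzMap hg₂
  have hψ : ∀ x, ψ x = (φ x : ℂ) := fun x => rfl
  have key := congrArg (fun D => D ψ) (Lp.fourier_toTemperedDistribution_eq h2.toLp)
  simp only [TemperedDistribution.fourier_apply, Lp.toTemperedDistribution_apply] at key
  calc ∫ x, φ x • (Lp.fourierTransformₗᵢ ℝ ℂ h2.toLp : ℝ → ℂ) x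
      = ∫ x, ψ x • (𝓕 h2.toLp : Lp ℂ 2 (volume : Measure ℝ)) x := by
        refine integral_congr_ae (ae_of_all _ fun x => ?_)
        simp only [hψ, Complex.coe_smul]
        rfl
    _ = ∫ x, (𝓕 ψ) x • (h2.toLp : ℝ → ℂ) x := key.symm
    _ = ∫ x, (𝓕 (ψ : ℝ → ℂ)) x • f x := by
        refine integral_congr_ae ?_
        filter_upwards [h2.coeFn_toLp] with x hx
        rw [hx, SchwartzMap.fourier_coe]
    -- Multiplication formula `∫ 𝓕ψ · f = ∫ ψ · 𝓕f` for integrable functions.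
    _ = ∫ x, ψ x • (𝓕 f) x := by
        simpa using! VectorFourier.integral_fourierIntegral_smul_eq_flip (L := innerₗ ℝ)
          Real.continuous_fourierChar continuous_inner ψ.integrable h1
    _ = _ := by simp only [hψ, Complex.coe_smul]

theorem coeFn_extendZero (f : L2Half) :
    (extendZero f : ℝ → ℂ) =ᵐ[volume] (Ioi (0 : ℝ)).indicator f :=
  (memLp_indicator_half f).coeFn_toLp

/-- If `g · 𝔏 f` is the Fourier transform of `w ∈ L²(ℝ)`, then `M_g f` is the restriction of `w` to
`(0,∞)`. -/
theorem coeFn_toeplitz_of_mulBoundary_eq {g : HInfLeft} {f : L2Half}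
    {w : Lp ℂ 2 (volume : Measure ℝ)}
    (hw : g.mulBoundary (laplaceBoundary f) = Lp.fourierTransformₗᵢ ℝ ℂ w) :
    (toeplitz g f : ℝ → ℂ) =ᵐ[volume.restrict (Ioi 0)] w := by
  set v : L2Half := ((Lp.memLp w).restrict (Ioi 0)).toLp
  have hvw : (v : ℝ → ℂ) =ᵐ[volume.restrict (Ioi 0)] w := MemLp.coeFn_toLp _
  -- `w` minus the extension of `v` vanishes on `(0,∞)`, hence is orthogonal to every zero
  -- extension; the unitary Fourier transform carries this over to the Hardy space.
  have horth : ∀ u : L2Half, inner ℂ (w - extendZero v) (extendZero u) = 0 := by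
    intro u
    rw [L2.inner_def]
    refine integral_eq_zero_of_ae ?_
    filter_upwards [coeFn_extendZero u, coeFn_extendZero v, Lp.coeFn_sub w (extendZero v),
      (ae_restrict_iff' measurableSet_Ioi).1 hvw] with t h1 h2 h3 h4
    rw [h1, h3, Pi.sub_apply, h2]
    by_cases ht : t ∈ Ioi (0 : ℝ)
    · simp [indicator_of_mem ht, h4 ht]
    · simp [indicator_of_notMem ht]
  have hproj : hardySpace.orthogonalProjectionOnto (g.mulBoundary (laplaceBoundary f)) =
      laplaceBoundary.equivRange v := by
    refine Subtype.ext ?_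
    rw [Submodule.coe_orthogonalProjectionOnto_apply, hw]
    refine Submodule.eq_starProjection_of_mem_of_inner_eq_zero
      (laplaceBoundary.equivRange v).2 ?_
    rintro _ ⟨u, rfl⟩
    change inner ℂ (Lp.fourierTransformₗᵢ ℝ ℂ w - Lp.fourierTransformₗᵢ ℝ ℂ (extendZero v))
      (Lp.fourierTransformₗᵢ ℝ ℂ (extendZero u)) = 0
    rw [← map_sub, LinearIsometryEquiv.inner_map_map, horth]
  rw [toeplitz, hproj, LinearIsometryEquiv.symm_apply_apply]
  exact hvw

/-- From `‖k‖² ≤ c ‖k‖`; this puts the convolution below, integrable and bounded, in `L²`. -/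
theorem memLp_two_of_integrable_of_bounded {α E : Type*} [MeasurableSpace α]
    [NormedAddCommGroup E] {μ : Measure α} {k : α → E} (hk : Integrable k μ) {c : ℝ}
    (hc : ∀ t, ‖k t‖ ≤ c) : MemLp k 2 μ := by
  rw [memLp_two_iff_integrable_sq_norm hk.1]
  refine (hk.norm.const_mul c).mono' (hk.1.norm.pow 2) (ae_of_all _ fun t => ?_)
  rw [norm_pow, norm_norm, sq]
  exact mul_le_mul_of_nonneg_right (hc t) (norm_nonneg _)

/-- The Toeplitz operator whose symbol is the Fourier transform of `h ∈ L¹(-∞,0]` is a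
one-sided convolution. -/
theorem coeFn_toeplitz_eq_integral {h : ℝ → ℂ} (hint : Integrable h)
    (hsupp : ∀ᵐ t : ℝ, 0 < t → h t = 0) {g : HInfLeft}
    (hg : ∀ᵐ ω : ℝ, g.boundary ω = ∫ t : ℝ, Complex.exp (-(Complex.I * ω * t)) * h t)
    {f : ℝ → ℂ} (hf1 : IntegrableOn f (Ioi 0)) {c : ℝ} (hfc : ∀ t, 0 < t → ‖f t‖ ≤ c)
    (hf2 : MemLp f 2 (volume.restrict (Ioi 0))) :
    ∀ᵐ t ∂(volume.restrict (Ioi (0 : ℝ))),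
      toeplitz g hf2.toLp t = ∫ s in Ioi (0 : ℝ), h (-s) * f (t + s) := by
  set φ : ℝ → ℂ := (Ioi (0 : ℝ)).indicator f with hφ
  have hφ1 : Integrable φ := hf1.integrable_indicator measurableSet_Ioi
  have hφ2 : MemLp φ 2 volume := (memLp_indicator_iff_restrict measurableSet_Ioi).2 hf2
  have hc0 : 0 ≤ c := (norm_nonneg _).trans (hfc 1 one_pos)
  have hφc : ∀ t, ‖φ t‖ ≤ c := by
    intro t
    by_cases ht : t ∈ Ioi (0 : ℝ)
    · rw [hφ, indicator_of_mem ht]; exact hfc t ht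
    · rw [hφ, indicator_of_notMem ht]; simpa using hc0
  set k : ℝ → ℂ := h ⋆[ContinuousLinearMap.mul ℂ ℂ] φ with hk
  have hk_apply : ∀ t, k t = ∫ u, h u * φ (t - u) := fun t => rfl
  have hk1 : Integrable k := hint.integrable_convolution _ hφ1
  have hkc : ∀ t, ‖k t‖ ≤ ∫ u, ‖h u‖ * c := fun t => by
    rw [hk_apply]
    refine norm_integral_le_of_norm_le (hint.norm.mul_const c) (ae_of_all _ fun u => ?_)
    rw [norm_mul]
    exact mul_le_mul_of_nonneg_left (hφc _) (norm_nonneg _)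
  have hk2 : MemLp k 2 volume := memLp_two_of_integrable_of_bounded hk1 hkc
  have hext : extendZero hf2.toLp = hφ2.toLp := by
    refine Lp.ext ?_
    filter_upwards [coeFn_extendZero hf2.toLp, hφ2.coeFn_toLp,
      (ae_restrict_iff' measurableSet_Ioi).1 hf2.coeFn_toLp] with t h1 h2 h3
    rw [h1, h2, hφ]
    by_cases ht : t ∈ Ioi (0 : ℝ)
    · rw [indicator_of_mem ht, indicator_of_mem ht, h3 ht]
    · rw [indicator_of_notMem ht, indicator_of_notMem ht]
  -- Change of frequency `ω = 2πξ`; the dilation pulls null sets back to null sets.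
  have hg' : ∀ᵐ ξ : ℝ, g.boundary (2 * Real.pi * ξ) = 𝓕 h ξ := by
    have hq : Measure.QuasiMeasurePreserving (fun ξ : ℝ => 2 * Real.pi * ξ) volume volume := by
      refine ⟨by fun_prop, ?_⟩
      rw [Real.map_volume_mul_left (by positivity)]
      exact Measure.smul_absolutelyContinuous
    filter_upwards [hq.ae hg] with ξ hξ
    rw [hξ, Real.fourier_real_eq_integral_exp_smul]
    refine integral_congr_ae (ae_of_all _ fun t => ?_)
    simp only [smul_eq_mul]
    congr 2
    push_cast
    ring
  have hmul : g.mulBoundary (laplaceBoundary hf2.toLp) = Lp.fourierTransformₗᵢ ℝ ℂ hk2.toLp := by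
    refine Lp.ext ?_
    have e : laplaceBoundary hf2.toLp = Lp.fourierTransformₗᵢ ℝ ℂ hφ2.toLp := by
      rw [← hext]; rfl
    rw [e]
    filter_upwards [(g.memLp_boundary_mul (Lp.fourierTransformₗᵢ ℝ ℂ hφ2.toLp)).coeFn_toLp,
      coeFn_fourierTransform_toLp hφ1 hφ2, coeFn_fourierTransform_toLp hk1 hk2, hg']
      with ξ h1 h2 h3 h4
    rw [HInfLeft.mulBoundary, h1, h2, h3, h4, hk, Real.fourier_mul_convolution_eq hint hφ1]
  filter_upwards [coeFn_toeplitz_of_mulBoundary_eq hmul, ae_restrict_of_ae hk2.coeFn_toLp,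
    ae_restrict_mem measurableSet_Ioi] with t h1 h2 ht
  -- Substituting `u = -s`: the part `s < 0` drops out by the support of `h`, the point `s = 0` is
  -- null, and for `s > 0` the argument `t + s` is positive, so the cut-off in `φ` is invisible.
  rw [h1, h2, hk_apply, ← integral_neg_eq_self]
  simp only [sub_neg_eq_add]
  have hsupp' : ∀ᵐ s : ℝ, s < 0 → h (-s) = 0 := by
    filter_upwards [(Measure.measurePreserving_neg (volume : Measure ℝ)).quasiMeasurePreserving.ae
      hsupp] with s hs h0 using hs (by linarith)
  rw [← setIntegral_eq_integral_of_ae_compl_eq_zero (s := Ioi 0)]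
  · refine setIntegral_congr_fun measurableSet_Ioi fun s hs => ?_
    have : t + s ∈ Ioi (0 : ℝ) := add_pos (mem_Ioi.1 ht) (mem_Ioi.1 hs)
    simp only [hφ, indicator_of_mem this]
  · filter_upwards [hsupp', Measure.ae_ne volume (0 : ℝ)] with s hs h0 hs'
    rw [hs (lt_of_le_of_ne (not_lt.1 hs') h0), zero_mul]
end Toeplitz

namespace C0Semigroup
variable {X : Type*} [NormedAddCommGroup X] [NormedSpace ℂ X] (T : C0Semigroup X)

/-! ### Orbits of the semigroup and the Phillips operator -/

theorem apply_add {s t : ℝ} (hs : 0 ≤ s) (ht : 0 ≤ t) (x : X) : T (s + t) x = T s (T t x) :=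
  congrArg (fun S : X →L[ℂ] X => S x) (T.at_add s t hs ht)

theorem apply_comm {s t : ℝ} (hs : 0 ≤ s) (ht : 0 ≤ t) (x : X) : T s (T t x) = T t (T s x) := by
  rw [← T.apply_add hs ht, add_comm, T.apply_add ht hs]

theorem generator_eq {x : T.domain} {y : X} (h : T.HasGenerator x y) : T.generator x = y :=
  (T.hasGenerator_choose x).unique T h

theorem hasGenerator_generator (x : T.domain) : T.HasGenerator x (T.generator x) :=
  T.hasGenerator_choose x

/-- The generator commutes with the semigroup on `D(A)`. -/
theorem generator_apply {t : ℝ} (ht : 0 ≤ t) (x : T.domain) :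
    T.generator ⟨T t x, T.apply_mem_domain ht x.2⟩ = T t (T.generator x) := by
  refine T.generator_eq ?_
  refine (((T t).continuous.tendsto _).comp (T.hasGenerator_generator x)).congr' ?_
  filter_upwards [self_mem_nhdsWithin] with r hr
  simp only [Function.comp_apply]
  rw [T.apply_comm (le_of_lt hr) ht, ← Complex.coe_smul, map_smul, map_sub, Complex.coe_smul]

variable {T} in
theorem IsExponentiallyStable.exists_bound (hT : T.IsExponentiallyStable) :
    ∃ M ε : ℝ, 0 ≤ M ∧ 0 < ε ∧ ∀ t : ℝ, 0 ≤ t → ‖T t‖ ≤ M * Real.exp (-ε * t) := by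
  obtain ⟨M, ε, hε, hM⟩ := hT
  exact ⟨M, ε, by simpa using (norm_nonneg _).trans (hM 0 le_rfl), hε, hM⟩

variable {T} in
theorem IsExponentiallyStable.exists_norm_le (hT : T.IsExponentiallyStable) :
    ∃ M : ℝ, 0 ≤ M ∧ ∀ t : ℝ, 0 ≤ t → ‖T t‖ ≤ M := by
  obtain ⟨M, ε, hM0, hε, hM⟩ := hT.exists_bound
  refine ⟨M, hM0, fun t ht => (hM t ht).trans (mul_le_of_le_one_right hM0 ?_)⟩
  exact Real.exp_le_one_iff.2 (by nlinarith)

theorem aestronglyMeasurable_orbit (x : X) :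
    AEStronglyMeasurable (fun t => T t x) (volume.restrict (Ioi 0)) :=
  ((T.continuousOn_orbit x).mono Ioi_subset_Ici_self).aestronglyMeasurable measurableSet_Ioi

theorem integrableOn_orbit (hT : T.IsExponentiallyStable) (x : X) :
    IntegrableOn (fun t => T t x) (Ioi 0) := by
  obtain ⟨M, ε, hM0, hε, hM⟩ := hT.exists_bound
  refine (((exp_neg_integrableOn_Ioi 0 hε).const_mul M).mul_const ‖x‖).mono'
    (T.aestronglyMeasurable_orbit x) ?_
  filter_upwards [ae_restrict_mem measurableSet_Ioi] with t ht
  exact ((T t).le_opNorm x).trans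
    (mul_le_mul_of_nonneg_right (hM t (le_of_lt ht)) (norm_nonneg _))

variable {T} in
theorem integrableOn_smul_orbit (hT : T.IsExponentiallyStable) {k : ℝ → ℂ}
    (hk : IntegrableOn k (Ioi 0)) (x : X) : IntegrableOn (fun s => k s • T s x) (Ioi 0) := by
  obtain ⟨M, hM0, hM⟩ := hT.exists_norm_le
  refine (hk.norm.mul_const (M * ‖x‖)).mono' (hk.1.smul (T.aestronglyMeasurable_orbit x)) ?_
  filter_upwards [ae_restrict_mem measurableSet_Ioi] with t ht
  rw [norm_smul]
  exact mul_le_mul_of_nonneg_left ((T t).le_of_opNorm_le (hM t (le_of_lt ht)) x) (norm_nonneg _)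

variable {T} in
/-- The operator `x ↦ ∫₀^∞ k(s) T(s)x ds` of the Phillips calculus. -/
noncomputable def phillips (hT : T.IsExponentiallyStable) {k : ℝ → ℂ} (hk : IntegrableOn k (Ioi 0)) :
    X →L[ℂ] X :=
  LinearMap.mkContinuousOfExistsBound
    { toFun := fun x => ∫ s in Ioi (0 : ℝ), k s • T s x
      map_add' := fun x x' => by
        simp only [map_add, smul_add]
        exact integral_add (integrableOn_smul_orbit hT hk x) (integrableOn_smul_orbit hT hk x')
      map_smul' := fun c x => by
        simp only [map_smul, RingHom.id_apply, smul_comm _ c]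
        exact integral_smul c _ } <| by
    obtain ⟨M, hM0, hM⟩ := hT.exists_norm_le
    refine ⟨∫ s in Ioi (0 : ℝ), ‖k s‖ * M, fun x => ?_⟩
    rw [← integral_mul_const]
    refine norm_integral_le_of_norm_le ((hk.norm.mul_const M).mul_const ‖x‖) ?_
    filter_upwards [ae_restrict_mem measurableSet_Ioi] with t ht
    rw [norm_smul, mul_assoc]
    exact mul_le_mul_of_nonneg_left ((T t).le_of_opNorm_le (hM t (le_of_lt ht)) x) (norm_nonneg _)

variable {T} in
theorem phillips_apply (hT : T.IsExponentiallyStable) {k : ℝ → ℂ} (hk : IntegrableOn k (Ioi 0))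
    (x : X) : phillips hT hk x = ∫ s in Ioi (0 : ℝ), k s • T s x := rfl

/-! ### Uniqueness and existence of `g(A)` -/

/-- An operator with the defining property of `g(A)` is unique. -/
theorem IsCalculusOperator.unique {T : C0Semigroup X} {hT : T.IsExponentiallyStable} {g : HInfLeft}
    {C C' : T.domain →ₗ[ℂ] X} (hC : T.IsCalculusOperator hT g C)
    (hC' : T.IsCalculusOperator hT g C') : C = C' := by
  -- Since `A T(t)x = T(t) A x`, the orbit of `x ∈ D(A)` tends to `x` in graph norm. Times range
  -- over a subtype because `T t x ∈ D(A)` needs `0 ≤ t`.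
  have hcont : ∀ {B : T.domain →ₗ[ℂ] X},
      (∃ c : ℝ, ∀ x : T.domain, ‖B x‖ ≤ c * (‖(x : X)‖ + ‖T.generator x‖)) → ∀ x : T.domain,
      Tendsto (fun t : Ici (0 : ℝ) => B ⟨T t x, T.apply_mem_domain t.2 x.2⟩)
        (comap Subtype.val (𝓝[>] 0)) (𝓝 (B x)) := by
    rintro B ⟨c, hc⟩ x
    have horb : ∀ z : X, Tendsto (fun t : Ici (0 : ℝ) => ‖T t z - z‖)
        (comap Subtype.val (𝓝[>] 0)) (𝓝 0) := by
      intro z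
      have h0 : Tendsto (fun t => T t z) (𝓝[>] 0) (𝓝 z) := by
        have := (T.continuousOn_orbit z 0 self_mem_Ici).tendsto
        rw [T.at_zero] at this
        exact this.mono_left (nhdsWithin_mono _ Ioi_subset_Ici_self)
      exact (tendsto_iff_norm_sub_tendsto_zero.1 h0).comp tendsto_comap
    rw [tendsto_iff_norm_sub_tendsto_zero]
    refine squeeze_zero (fun _ => norm_nonneg _) (fun t => ?_)
      (g := fun t : Ici (0 : ℝ) => c * (‖T t x - x‖ + ‖T t (T.generator x) - T.generator x‖)) ?_
    · rw [← map_sub]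
      refine (hc _).trans (le_of_eq ?_)
      rw [map_sub, T.generator_apply t.2 x]
      rfl
    · simpa using ((horb x).add (horb (T.generator x))).const_mul c
  refine LinearMap.ext fun x => ?_
  rw [← sub_eq_zero]
  refine SeparatingDual.eq_zero_of_forall_dual_eq_zero (R := ℂ) fun y => ?_
  rw [map_sub, sub_eq_zero]
  have hae := (ae_restrict_iff' measurableSet_Ioi).1 ((hC.2 y x).and (hC'.2 y x))
  -- Each `(0, ε)` has positive measure, so it contains a time at which the almost-everywhere
  -- identities hold.
  have hfreq : ∃ᶠ t in 𝓝[>] (0 : ℝ), ∀ ht : 0 ≤ t,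
      y (C ⟨T t x, T.apply_mem_domain ht x.2⟩) = y (C' ⟨T t x, T.apply_mem_domain ht x.2⟩) := by
    refine (nhdsGT_basis (0 : ℝ)).frequently_iff.2 fun ε hε => ?_
    have hpos : volume (Ioo 0 ε) ≠ 0 := by simpa using hε
    obtain ⟨t, ht, h⟩ := (frequently_ae_mem_iff.2 hpos).and_eventually hae |>.exists
    exact ⟨t, ht, fun h0 => ((h ht.1).1 h0).symm.trans ((h ht.1).2 h0)⟩
  have hfreq' : ∃ᶠ t : Ici (0 : ℝ) in comap Subtype.val (𝓝[>] (0 : ℝ)),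
      y (C ⟨T t x, T.apply_mem_domain t.2 x.2⟩) = y (C' ⟨T t x, T.apply_mem_domain t.2 x.2⟩) := by
    rw [frequently_comap]
    refine (hfreq.and_eventually self_mem_nhdsWithin).mono fun t ht => ?_
    exact ⟨⟨t, le_of_lt ht.2⟩, rfl, ht.1 (le_of_lt ht.2)⟩
  exact tendsto_nhds_unique_of_frequently_eq ((y.continuous.tendsto _).comp (hcont hC.1 x))
    ((y.continuous.tendsto _).comp (hcont hC'.1 x)) hfreq'

/-- Existence rules out the default value `0` of `calculus`, and uniqueness identifies the chosen
operator. -/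
theorem IsCalculusOperator.calculus_eq {T : C0Semigroup X} {hT : T.IsExponentiallyStable}
    {g : HInfLeft} {C : T.domain →ₗ[ℂ] X} (hC : T.IsCalculusOperator hT g C) :
    T.calculus hT g = C := by
  have h : ∃ C, T.IsCalculusOperator hT g C := ⟨C, hC⟩
  rw [calculus, dif_pos h]
  exact IsCalculusOperator.unique (Classical.choose_spec h) hC

variable [CompleteSpace X]

/-- Exponential stability makes each scalar orbit bounded and integrable, so the one-sided
convolution formula applies; `y` is then pulled out of the integral. -/
theorem phillips_isCalculusOperator {T : C0Semigroup X} (hT : T.IsExponentiallyStable)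
    {h : ℝ → ℂ} (hint : Integrable h) (hsupp : ∀ᵐ t : ℝ, 0 < t → h t = 0) {g : HInfLeft}
    (hg : ∀ᵐ ω : ℝ, g.boundary ω = ∫ t : ℝ, Complex.exp (-(Complex.I * ω * t)) * h t) :
    T.IsCalculusOperator hT g
      ((phillips hT hint.comp_neg.integrableOn : X →L[ℂ] X).toLinearMap ∘ₗ T.domain.subtype) := by
  set E := phillips hT hint.comp_neg.integrableOn
  refine ⟨⟨‖E‖, fun x => (E.le_opNorm x).trans
    (mul_le_mul_of_nonneg_left (le_add_of_nonneg_right (norm_nonneg _)) (norm_nonneg _))⟩,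
    fun y x => ?_⟩
  obtain ⟨M, hM0, hM⟩ := hT.exists_norm_le
  have hbd : ∀ t, 0 < t → ‖y (T t x)‖ ≤ ‖y‖ * (M * ‖(x : X)‖) := fun t ht =>
    (y.le_opNorm _).trans (mul_le_mul_of_nonneg_left
      ((T t).le_of_opNorm_le (hM t ht.le) _) (norm_nonneg _))
  filter_upwards [coeFn_toeplitz_eq_integral hint hsupp hg
    (y.integrable_comp (T.integrableOn_orbit hT x)) hbd (T.memLp_orbit hT y x)] with t h1 ht
  rw [outputMap, h1]
  change _ = y (E (T t x))
  rw [phillips_apply, ← y.integral_comp_comm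
    (integrableOn_smul_orbit hT hint.comp_neg.integrableOn _)]
  refine setIntegral_congr_fun measurableSet_Ioi fun s hs => ?_
  simp only [map_smul, smul_eq_mul]
  rw [add_comm t s, T.apply_add (le_of_lt hs) ht]

/-! ### Density of `D(A)` -/

/-- The domain of the generator is dense. -/
theorem dense_domain : Dense (T.domain : Set X) := by
  have hII : ∀ (x : X) {a b : ℝ}, 0 ≤ a → 0 ≤ b →
      IntervalIntegrable (fun s => T s x) volume a b := fun x a b ha hb =>
    ((T.continuousOn_orbit x).mono fun s hs => (le_min ha hb).trans hs.1).intervalIntegrable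
  have hderiv : ∀ (x : X) {t : ℝ}, 0 ≤ t →
      HasDerivWithinAt (fun u => ∫ s in (0 : ℝ)..u, T s x) (T t x) (Ioi t) t := by
    intro x t ht
    have hc : ContinuousWithinAt (fun s => T s x) (Ioi t) t :=
      (T.continuousOn_orbit x t ht).mono fun s hs => ht.trans (le_of_lt hs)
    refine (intervalIntegral.integral_hasDerivWithinAt_right (hII x le_rfl ht)
      (s := Ici t) (t := Ioi t) ?_ hc).mono Ioi_subset_Ici_self
    exact (((T.continuousOn_orbit x).mono fun s hs =>
      ht.trans (le_of_lt hs)).stronglyMeasurableAtFilter_nhdsWithin measurableSet_Ioi t)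
  have hmem : ∀ (x : X) {t : ℝ}, 0 ≤ t → ∫ s in (0 : ℝ)..t, T s x ∈ T.domain := by
    intro x t ht
    -- With `F(t) = ∫₀ᵗ T(s)x ds`, one has `T(r)F(t) - F(t) = (F(t+r) - F(t)) - (F(r) - F(0))`, so
    -- the generator quotient is a difference of two slopes of `F`.
    refine ⟨T t x - T 0 x, ?_⟩
    have h1 := (hasDerivWithinAt_iff_tendsto_slope' (by simp)).1 (hderiv x ht)
    have h0 := (hasDerivWithinAt_iff_tendsto_slope' (by simp)).1 (hderiv x le_rfl)
    have hshift : Tendsto (fun r : ℝ => t + r) (𝓝[>] 0) (𝓝[>] t) := by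
      refine tendsto_nhdsWithin_iff.2 ⟨?_, ?_⟩
      · have : Tendsto (fun r : ℝ => t + r) (𝓝 0) (𝓝 (t + 0)) :=
          tendsto_const_nhds.add tendsto_id
        rw [add_zero] at this
        exact this.mono_left nhdsWithin_le_nhds
      · filter_upwards [self_mem_nhdsWithin] with r hr
        simpa using hr
    refine ((h1.comp hshift).sub h0).congr' ?_
    filter_upwards [self_mem_nhdsWithin] with r hr
    have hr' : (0 : ℝ) ≤ r := le_of_lt hr
    have hT1 : T r (∫ s in (0 : ℝ)..t, T s x) = ∫ s in r..(t + r), T s x := by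
      rw [← ContinuousLinearMap.intervalIntegral_comp_comm _ (hII x le_rfl ht)]
      have := intervalIntegral.integral_comp_add_right (a := 0) (b := t) (fun s => T s x) r
      rw [zero_add] at this
      rw [← this]
      refine intervalIntegral.integral_congr fun s hs => ?_
      rw [uIcc_of_le ht] at hs
      rw [add_comm s r, T.apply_add hr' hs.1]
    simp only [Function.comp_apply, slope_def_module, add_sub_cancel_left, sub_zero,
      intervalIntegral.integral_same]
    rw [hT1, ← smul_sub]
    congr 1
    have := intervalIntegral.integral_add_adjacent_intervals (hII x le_rfl hr')
      (hII x hr' (add_nonneg ht hr'))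
    rw [← this]
    abel
  intro x
  -- The averages `t⁻¹ F(t)` lie in `D(A)` and tend to `F'(0) = x`.
  refine mem_closure_of_tendsto
    (f := fun t : ℝ => t⁻¹ • ∫ s in (0 : ℝ)..t, T s x) (b := 𝓝[>] 0) ?_ ?_
  · have h0 := (hasDerivWithinAt_iff_tendsto_slope' (by simp)).1 (hderiv x le_rfl)
    rw [T.at_zero] at h0
    refine h0.congr fun t => ?_
    simp [slope_def_module]
  · filter_upwards [self_mem_nhdsWithin] with t ht
    rw [← Complex.coe_smul]
    exact T.domain.smul_mem _ (hmem x (le_of_lt ht))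

end C0Semigroup

theorem lemma2p13 {X : Type*} [NormedAddCommGroup X] [NormedSpace ℂ X] [CompleteSpace X]
    (T : C0Semigroup X) (hT : T.IsExponentiallyStable)
    (h : ℝ → ℂ) (hint : Integrable h) (hsupp : ∀ᵐ t : ℝ, 0 < t → h t = 0)
    (g : HInfLeft)
    (hg : ∀ᵐ ω : ℝ, g.boundary ω = ∫ t : ℝ, Complex.exp (-(Complex.I * ω * t)) * h t) :
    (∃! C : T.domain →ₗ[ℂ] X, T.IsCalculusOperator hT g C) ∧
    T.IsCalculusOperator hT g (T.calculus hT g) ∧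
    (∀ x : X, IntegrableOn (fun s : ℝ => h (-s) • T s x) (Ioi 0)) ∧
    (∀ x : T.domain, T.calculus hT g x = ∫ s in Ioi (0 : ℝ), h (-s) • T s x) ∧
    ∃ E : X →L[ℂ] X,
      (∀ x : T.domain, E x = T.calculus hT g x) ∧
      (∀ E' : X →L[ℂ] X, (∀ x : T.domain, E' x = T.calculus hT g x) → E' = E) ∧
      ∀ x : X, E x = ∫ s in Ioi (0 : ℝ), h (-s) • T s x := by
  have hC := C0Semigroup.phillips_isCalculusOperator hT hint hsupp hg
  have hcalc := hC.calculus_eq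
  have hk : IntegrableOn (fun s => h (-s)) (Ioi 0) := hint.comp_neg.integrableOn
  have happ : ∀ x : T.domain, C0Semigroup.phillips hT hk x = T.calculus hT g x := fun x => by
    rw [hcalc]; rfl
  refine ⟨⟨_, hC, fun C hC' => hC'.unique hC⟩, hcalc ▸ hC,
    C0Semigroup.integrableOn_smul_orbit hT hk,
    fun x => (happ x).symm, C0Semigroup.phillips hT hk, happ, fun E' hE' => ?_, fun x => rfl⟩
  refine ContinuousLinearMap.coeFn_injective
    (Continuous.ext_on T.dense_domain E'.continuous (C0Semigroup.phillips hT hk).continuous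
      fun x hx => ?_)
  exact (hE' ⟨x, hx⟩).trans (happ ⟨x, hx⟩).symm
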